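/- For a finite simple graph $G$, write $d(v)$ for the degree of a vertex $v$ and let $\sigma_t(G)=\sum_{\{u,v\}\subseteq V(G)}(d(u)-d(v))^2$, the sum running over all unordered pairs of distinct vertices. For non-negative integers $a,b$, let $S_{a,b}$ denote the split graph whose vertex set is partitioned into a clique of size $a$ and an independent set of size $b$, with every vertex of the independent set adjacent to every vertex of the clique. Let $n\ge 3$ be an integer. Then every connected simple graph $\Gamma$ on $n$ vertices satisfies $$ \sigma_t(\Gamma)\le \begin{cases} \lceil \frac n4\rceil\cdot\lfloor\frac{3n}4\rfloor\,\bigl(n-1-\lceil\frac n4\rceil\bigr)^2, & \text{if } n\equiv 0 \text{ or } 3 \pmod 4,\\[2pt] \lfloor \frac n4\rfloor\cdot\lceil\frac{3n}4\rceil\,\bigl(n-1-\lfloor\frac n4\rfloor\bigr)^2, & \text{if } n\equiv 1 \text{ or } 2 \pmod 4. \end{cases} $$ If $n\equiv 0$ or $3\pmod 4$, the split graph $S_{\lceil n/4\rceil,\lfloor 3n/4\rfloor}$ is a connected graph on $n$ vertices for which equality holds; if $n\equiv 1$ or $2\pmod 4$, the split graph $S_{\lfloor n/4\rfloor,\lceil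 3n/4\rceil}$ is a connected graph on $n$ vertices for which equality holds. -/

import Mathlib

/-- The `σ_t`-irregularity (sigma total index): the sum of `(d(u) - d(v))²` over all unordered
pairs `{u, v}` of distinct vertices. -/
def SimpleGraph.sigmaTotal {V : Type*} [Fintype V] [DecidableEq V]
    (G : SimpleGraph V) [DecidableRel G.Adj] : ℤ :=
  ∑ e : Sym2 V with ¬ e.IsDiag,
    Sym2.lift ⟨fun u v => ((G.degree u : ℤ) - (G.degree v : ℤ)) ^ 2,
      fun u v => by ring⟩ e

/-- `G` is a split graph `S_{a,b}`: its vertices are partitioned into a clique of size `a` and an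
independent set of size `b`, every vertex of the independent set being adjacent to every vertex of
the clique. -/
def SimpleGraph.IsSplitGraph {V : Type*} [Fintype V] [DecidableEq V]
    (G : SimpleGraph V) (a b : ℕ) : Prop :=
  ∃ A B : Finset V, Disjoint A B ∧ A ∪ B = Finset.univ ∧ A.card = a ∧ B.card = b ∧
    G.IsClique (A : Set V) ∧ G.IsIndepSet (B : Set V) ∧ ∀ u ∈ A, ∀ v ∈ B, G.Adj u v

/-!
Adding an edge `uv` changes `σ_t` by an affine function of `d(u) + d(v)`, so a graph maximizing
`σ_t` is a threshold graph and arises by adding isolated and dominating vertices one at a time.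
For such graphs `σ_t` is determined by the sequence of surpluses (edges minus non-edges): it is
`n ((n - 2) λ_n - ∑_{j < n} λ_j)`, where `λ_j` is the product of the numbers of edges and non-edges
among the first `j` vertices divided by the number of pairs.

Since the surplus changes by exactly `j` at step `j`, its last value bounds every `λ_j` from below.
If the more frequent of edges and non-edges occurs `C(b, 2) + r` times with `0 ≤ r ≤ b`, this gives
an upper bound for `σ_t` that is quadratic in `r` and at most the value of the split graph with `b`
or `b + 1` independent vertices, unless `3n - 4b` is `1` or `2`. In that case the surplus cannot
attain its extreme values at both `b` and `b + 1`, and the resulting slack suffices. The split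
values are unimodal in `b`, with maximum at `b = ⌊(3n + 2) / 4⌋`.
-/

open Finset SimpleGraph

section

variable {V : Type*} [Fintype V] [DecidableEq V]

theorem two_mul_sigmaTotal (G : SimpleGraph V) [DecidableRel G.Adj] :
    2 * G.sigmaTotal = ∑ u, ∑ v, ((G.degree u : ℤ) - G.degree v) ^ 2 := by
  have offDiag_sum : ∑ u, ∑ v, ((G.degree u : ℤ) - G.degree v) ^ 2 =
      ∑ p ∈ (univ : Finset V).offDiag, ((G.degree p.1 : ℤ) - G.degree p.2) ^ 2 := by
    rw [← sum_product', ← diag_union_offDiag, sum_union (disjoint_diag_offDiag _)]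
    simp
  rw [offDiag_sum, sigmaTotal, mul_sum,
    ← sum_fiberwise_of_maps_to (s := (univ : Finset V).offDiag)
      (t := univ.filter fun e : Sym2 V => ¬ e.IsDiag) (g := fun p => s(p.1, p.2)) (by simp)]
  refine sum_congr rfl fun e he => ?_
  induction e using Sym2.inductionOn with
  | hf a b =>
    have hab : a ≠ b := by simpa using he
    have fiber : (univ : Finset V).offDiag.filter (fun p => s(p.1, p.2) = s(a, b)) =
        {(a, b), (b, a)} := by
      ext ⟨x, y⟩
      simp only [mem_filter, mem_offDiag, mem_univ, true_and, Sym2.eq_iff, mem_insert,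
        mem_singleton, Prod.mk.injEq]
      grind
    rw [fiber, sum_pair (by simp [hab]), Sym2.lift_mk]
    ring

theorem sigmaTotal_eq_sum_degree (G : SimpleGraph V) [DecidableRel G.Adj] :
    G.sigmaTotal = Fintype.card V * ∑ v, (G.degree v : ℤ) ^ 2 - (∑ v, (G.degree v : ℤ)) ^ 2 := by
  have expand : ∑ u, ∑ v, ((G.degree u : ℤ) - G.degree v) ^ 2 =
      2 * (Fintype.card V * ∑ v, (G.degree v : ℤ) ^ 2 - (∑ v, (G.degree v : ℤ)) ^ 2) := by
    simp only [sub_sq, sum_add_distrib, sum_sub_distrib, ← mul_sum, ← sum_mul, sum_const,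
      card_univ, nsmul_eq_mul]
    ring
  linarith [two_mul_sigmaTotal G]

theorem degree_sup_edge {G : SimpleGraph V} [DecidableRel G.Adj] {u v : V} (huv : u ≠ v)
    (hadj : ¬ G.Adj u v) [DecidableRel (G ⊔ edge u v).Adj] (w : V) :
    ((G ⊔ edge u v).degree w : ℤ) =
      G.degree w + (if w = u then 1 else 0) + if w = v then 1 else 0 := by
  have hnbr : (G ⊔ edge u v).neighborFinset w = G.neighborFinset w ∪
      ((if w = u then {v} else ∅) ∪ if w = v then {u} else ∅) := by
    ext x
    simp only [mem_neighborFinset, sup_adj, edge_adj, mem_union]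
    grind
  have hdisj : Disjoint (G.neighborFinset w)
      ((if w = u then {v} else ∅) ∪ if w = v then {u} else ∅) := by
    rw [Finset.disjoint_left]
    intro x hx
    have := G.adj_comm u v
    grind [mem_neighborFinset]
  rw [← card_neighborFinset_eq_degree, hnbr, card_union_of_disjoint hdisj,
    card_neighborFinset_eq_degree]
  by_cases hwu : w = u <;> by_cases hwv : w = v <;> grind

/-- The change is affine in `d(u) + d(v)`, so in a maximizer of `σ_t` a threshold on `d(u) + d(v)`
decides adjacency. -/
theorem sigmaTotal_sup_edge {G : SimpleGraph V} [DecidableRel G.Adj] {u v : V} (huv : u ≠ v)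
    (hadj : ¬ G.Adj u v) [DecidableRel (G ⊔ edge u v).Adj] :
    (G ⊔ edge u v).sigmaTotal = G.sigmaTotal +
      2 * Fintype.card V * ((G.degree u : ℤ) + G.degree v + 1) -
      4 * (∑ w, (G.degree w : ℤ) + 1) := by
  have hsq (w : V) : ((G ⊔ edge u v).degree w : ℤ) ^ 2 = (G.degree w : ℤ) ^ 2 +
      (if w = u then 2 * (G.degree u : ℤ) + 1 else 0) +
      if w = v then 2 * (G.degree v : ℤ) + 1 else 0 := by
    rw [degree_sup_edge huv hadj]
    grind
  rw [sigmaTotal_eq_sum_degree, sigmaTotal_eq_sum_degree G, sum_congr rfl fun w _ => hsq w]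
  simp only [degree_sup_edge huv hadj, sum_add_distrib, sum_ite_eq', mem_univ, if_true]
  ring

/-- Threshold graphs in the sense of Chvátal and Hammer; integer weights lose no generality on
finite graphs. -/
def IsThreshold {V : Type*} (G : SimpleGraph V) : Prop :=
  ∃ (w : V → ℤ) (t : ℤ), ∀ u v, u ≠ v → (G.Adj u v ↔ t < w u + w v)

theorem IsThreshold.exists_isolated_or_dominating {V : Type*} {G : SimpleGraph V}
    (hG : IsThreshold G) {s : Finset V} (hs : s.Nonempty) :
    ∃ v ∈ s, (∀ u ∈ s, u ≠ v → ¬ G.Adj v u) ∨ ∀ u ∈ s, u ≠ v → G.Adj v u := by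
  obtain ⟨w, t, hadj⟩ := hG
  obtain ⟨a, ha, hmin⟩ := s.exists_min_image w hs
  obtain ⟨b, hb, hmax⟩ := s.exists_max_image w hs
  rcases lt_or_ge t (w a + w b) with h | h
  · refine ⟨b, hb, Or.inr fun u hu hub => (hadj b u hub.symm).mpr ?_⟩
    linarith [hmin u hu]
  · refine ⟨a, ha, Or.inl fun u hu hua => (hadj a u hua.symm).not.mpr ?_⟩
    linarith [hmax u hu]

theorem isThreshold_of_forall_sigmaTotal_le {G : SimpleGraph V} [DecidableRel G.Adj]
    (hV : 3 ≤ Fintype.card V)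
    (hmax : ∀ (H : SimpleGraph V) [DecidableRel H.Adj], H.sigmaTotal ≤ G.sigmaTotal) :
    IsThreshold G := by
  classical
  have : (3 : ℤ) ≤ Fintype.card V := by exact_mod_cast hV
  refine ⟨fun w => Fintype.card V * G.degree w, 2 * ∑ w, (G.degree w : ℤ), fun u v huv => ?_⟩
  by_cases hadj : G.Adj u v
  · obtain ⟨H, hH, rfl⟩ : ∃ H, ¬ H.Adj u v ∧ H ⊔ edge u v = G :=
      ⟨G \ edge u v, by simp [edge_adj, huv],
        sdiff_sup_cancel ((edge_le_iff _).mpr (Or.inr hadj))⟩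
    have hle := hmax H
    rw [sigmaTotal_sup_edge huv hH] at hle
    simp only [hadj, true_iff, degree_sup_edge huv hH, sum_add_distrib, sum_ite_eq', mem_univ,
      if_true, huv, huv.symm, if_false]
    linarith
  · have hle := hmax (G ⊔ edge u v)
    rw [sigmaTotal_sup_edge huv hadj] at hle
    simp only [hadj, false_iff, not_lt]
    linarith

theorem exists_isThreshold_sigmaTotal_le (hV : 3 ≤ Fintype.card V)
    (G : SimpleGraph V) [DecidableRel G.Adj] :
    ∃ (H : SimpleGraph V) (_ : DecidableRel H.Adj), IsThreshold H ∧
      G.sigmaTotal ≤ H.sigmaTotal := by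
  classical
  obtain ⟨H, hH⟩ := Finite.exists_max fun H : SimpleGraph V => H.sigmaTotal
  have hmax (K : SimpleGraph V) [DecidableRel K.Adj] : K.sigmaTotal ≤ H.sigmaTotal :=
    le_of_eq_of_le (by congr!) (hH K)
  exact ⟨H, inferInstance, isThreshold_of_forall_sigmaTotal_le hV hmax, hmax G⟩

end

section

variable {V : Type*} (G : SimpleGraph V) [DecidableRel G.Adj]

/-- The degree of `v` into `s`; for `v ∈ s`, its degree in the subgraph induced on `s`. -/
def degreeIn (s : Finset V) (v : V) : ℕ := #{w ∈ s | G.Adj v w}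

theorem degreeIn_univ [Fintype V] (v : V) : degreeIn G univ v = G.degree v := by
  rw [degreeIn, ← neighborFinset_eq_filter, card_neighborFinset_eq_degree]

variable {G} [DecidableEq V] {s : Finset V} {v : V}

theorem sum_degreeIn_insert_of_isolated (hv : v ∉ s) (h : ∀ w ∈ s, ¬ G.Adj v w) (f : ℕ → ℤ) :
    ∑ u ∈ insert v s, f (degreeIn G (insert v s) u) = f 0 + ∑ u ∈ s, f (degreeIn G s u) := by
  have hself : degreeIn G (insert v s) v = 0 := by
    simpa [degreeIn, filter_eq_empty_iff] using h
  have hrest : ∀ u ∈ s, degreeIn G (insert v s) u = degreeIn G s u := fun u hu => by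
    rw [degreeIn, filter_insert, if_neg fun huv => h u hu huv.symm, degreeIn]
  rw [sum_insert hv, hself, sum_congr rfl fun u hu => by rw [hrest u hu]]

theorem sum_degreeIn_insert_of_dominating (hv : v ∉ s) (h : ∀ w ∈ s, G.Adj v w) (f : ℕ → ℤ) :
    ∑ u ∈ insert v s, f (degreeIn G (insert v s) u) =
      f #s + ∑ u ∈ s, f (degreeIn G s u + 1) := by
  have hself : degreeIn G (insert v s) v = #s := by
    rw [degreeIn, filter_insert, if_neg (G.irrefl), filter_true_of_mem h]
  have hrest : ∀ u ∈ s, degreeIn G (insert v s) u = degreeIn G s u + 1 := fun u hu => by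
    rw [degreeIn, filter_insert, if_pos (h u hu).symm, card_insert_of_notMem (by simp [hv]),
      degreeIn]
  rw [sum_insert hv, hself, sum_congr rfl fun u hu => by rw [hrest u hu]]

end

/-- `x j` is the number of edges minus the number of non-edges among the first `j` vertices of a
graph built by adding isolated and dominating vertices one at a time. The sequence is infinite;
a graph on `n` vertices prescribes its values up to `n`. -/
structure IsSurplusSeq (x : ℕ → ℤ) : Prop where
  zero : x 0 = 0
  step : ∀ j, |x (j + 1) - x j| = j

/-- Edges times non-edges over pairs, for a graph on `j` vertices with surplus `x j`. It is `0`
for `j ≤ 1`, where the denominator vanishes. -/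
def pairBalance (x : ℕ → ℤ) (j : ℕ) : ℚ :=
  ((j.choose 2 : ℚ) ^ 2 - (x j : ℚ) ^ 2) / (4 * j.choose 2)

/-- The `σ_t`-irregularity of the graph on `n` vertices with surplus sequence `x`, as the solution
of the recursion `IsSurplusSeq.mul_surplusSigma_succ`. -/
def surplusSigma (n : ℕ) (x : ℕ → ℤ) : ℚ :=
  n * ((n - 2) * pairBalance x n - ∑ j ∈ range n, pairBalance x j)

theorem choose_two_succ (j : ℕ) : (j + 1).choose 2 = j.choose 2 + j := by
  rw [Nat.choose_succ_succ' j 1, Nat.choose_one_right, add_comm]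

theorem surplusSigma_congr {n : ℕ} {x y : ℕ → ℤ} (h : ∀ j ≤ n, x j = y j) :
    surplusSigma n x = surplusSigma n y := by
  have hbal (j : ℕ) (hj : j ≤ n) : pairBalance x j = pairBalance y j := by
    rw [pairBalance, h j hj, pairBalance]
  rw [surplusSigma, hbal n le_rfl, sum_congr rfl fun j hj => hbal j (mem_range.mp hj).le,
    surplusSigma]

namespace IsSurplusSeq

theorem choose_two : IsSurplusSeq fun j => (j.choose 2 : ℤ) where
  zero := rfl
  step j := by simp [choose_two_succ]

theorem exists_extension {x : ℕ → ℤ} (hx : IsSurplusSeq x) {k : ℕ} {c : ℤ} (hc : |c - x k| = k) :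
    ∃ y, IsSurplusSeq y ∧ (∀ j ≤ k, y j = x j) ∧ y (k + 1) = c := by
  refine ⟨fun j => if j ≤ k then x j else x j + (c - x (k + 1)), ⟨by simp [hx.zero], fun j => ?_⟩,
    fun j hj => if_pos hj, by simp⟩
  rcases lt_trichotomy j k with hj | rfl | hj
  · simpa [hj.le, Nat.succ_le_of_lt hj] using hx.step j
  · simpa using hc
  · simpa [hj.not_ge, (hj.trans j.lt_succ_self).not_ge] using hx.step j

theorem one {x : ℕ → ℤ} (hx : IsSurplusSeq x) : x 1 = 0 := by
  simpa [hx.zero] using hx.step 0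

theorem mul_surplusSigma_succ {x : ℕ → ℤ} (hx : IsSurplusSeq x) {k : ℕ} (hk : 1 ≤ k) :
    (k : ℚ) * surplusSigma (k + 1) x = (k + 1) * surplusSigma k x +
      ((k.choose 2 : ℚ) ^ 2 + (x k : ℚ) ^ 2 - (k - 1) * x k * (x (k + 1) - x k)) := by
  have hstep : ((x (k + 1) : ℚ) - x k) ^ 2 = (k : ℚ) ^ 2 := by
    have h : (x (k + 1) - x k) ^ 2 = (k : ℤ) ^ 2 := by rw [← sq_abs, hx.step k]
    exact_mod_cast h
  have hk0 : (k : ℚ) ≠ 0 := by positivity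
  rcases hk.eq_or_lt with rfl | hk2
  · simp [surplusSigma, pairBalance, hx.one, sum_range_succ]
  · have hk1 : (k : ℚ) - 1 ≠ 0 := by
      have : (1 : ℚ) < k := by exact_mod_cast hk2
      linarith
    have hsucc : (x (k + 1) : ℚ) ^ 2 = (k : ℚ) ^ 2 + 2 * x k * (x (k + 1) - x k) + x k ^ 2 := by
      linear_combination hstep
    simp only [surplusSigma, sum_range_succ, pairBalance, hsucc, Nat.cast_choose_two,
      Nat.cast_succ, add_sub_cancel_right]
    field_simp
    ring

/-- `D`, `Q` and `D'`, `Q'` are the sums of the degrees and of their squares before and after a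
vertex joins `k` others; `δ = k` when it is dominating and `δ = -k` when it is isolated. -/
theorem exists_succ {x : ℕ → ℤ} (hx : IsSurplusSeq x) {k : ℕ} (hk : 1 ≤ k) {D Q D' Q' δ : ℤ}
    (hδ : |δ| = k) (hD : D = k.choose 2 + x k) (hsigma : (k * Q - D ^ 2 : ℤ) = surplusSigma k x)
    (hD' : D' = D + (k + δ)) (hQ' : 2 * k * Q' = 2 * k * Q + (k + δ) * (2 * D + k + k ^ 2)) :
    ∃ y, IsSurplusSeq y ∧ D' = (k + 1).choose 2 + y (k + 1) ∧
      ((k + 1 : ℕ) * Q' - D' ^ 2 : ℤ) = surplusSigma (k + 1) y := by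
  obtain ⟨y, hy, hyx, hyc⟩ := hx.exists_extension (k := k) (c := x k + δ) (by simpa using hδ)
  have hδsq : (δ : ℚ) ^ 2 = (k : ℚ) ^ 2 := by
    have h : δ ^ 2 = (k : ℤ) ^ 2 := by rw [← sq_abs, hδ]
    exact_mod_cast h
  have hk0 : (k : ℚ) ≠ 0 := by positivity
  refine ⟨y, hy, ?_, mul_left_cancel₀ hk0 ?_⟩
  · rw [hyc, hD', hD, choose_two_succ]
    push_cast
    ring
  · rw [hy.mul_surplusSigma_succ hk, surplusSigma_congr hyx, ← hsigma, hyx k le_rfl, hyc]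
    have hQq : 2 * (k : ℚ) * Q' = 2 * k * Q + (k + δ) * (2 * D + k + k ^ 2) := by
      exact_mod_cast hQ'
    subst hD' hD
    push_cast [Nat.cast_choose_two] at hQq ⊢
    linear_combination (k + 1) / 2 * hQq - k * hδsq

end IsSurplusSeq

section

variable {V : Type*} {G : SimpleGraph V} [DecidableRel G.Adj]

theorem IsThreshold.exists_isSurplusSeq_degreeIn (hG : IsThreshold G) (k : ℕ) :
    ∀ s : Finset V, #s = k + 1 → ∃ x, IsSurplusSeq x ∧
      ∑ v ∈ s, (degreeIn G s v : ℤ) = (k + 1).choose 2 + x (k + 1) ∧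
      ((k + 1 : ℕ) * ∑ v ∈ s, (degreeIn G s v : ℤ) ^ 2 - (∑ v ∈ s, (degreeIn G s v : ℤ)) ^ 2 : ℤ) =
        surplusSigma (k + 1) x := by
  classical
  induction k with
  | zero =>
    intro s hs
    obtain ⟨v, rfl⟩ := card_eq_one.mp hs
    exact ⟨_, IsSurplusSeq.choose_two, by simp [degreeIn, filter_singleton],
      by simp [degreeIn, surplusSigma, pairBalance, filter_singleton]⟩
  | succ k ih =>
    intro s hs
    obtain ⟨v, hv, hv'⟩ := hG.exists_isolated_or_dominating (card_pos.mp (by omega : 0 < #s))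
    obtain ⟨s, hvs, rfl⟩ : ∃ t, v ∉ t ∧ insert v t = s := ⟨s.erase v, by simp, insert_erase hv⟩
    rw [card_insert_of_notMem hvs, Nat.succ_inj] at hs
    obtain ⟨x, hx, hsum, hsigma⟩ := ih s hs
    have hstep {δ D' Q' : ℤ} (hδ : |δ| = (k + 1 : ℕ)) :=
      hx.exists_succ (D' := D') (Q' := Q') k.succ_pos hδ hsum hsigma
    rcases hv' with hiso | hdom
    · have hsums := sum_degreeIn_insert_of_isolated hvs
        fun u hu => hiso u (mem_insert_of_mem hu) (ne_of_mem_of_not_mem hu hvs)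
      refine hstep (δ := -(k + 1 : ℕ)) (by rw [abs_neg, Nat.abs_cast]) ?_ ?_
      · rw [hsums fun d => (d : ℤ)]
        push_cast
        ring
      · rw [hsums fun d => (d : ℤ) ^ 2]
        push_cast
        ring
    · have hsums := sum_degreeIn_insert_of_dominating hvs
        fun u hu => hdom u (mem_insert_of_mem hu) (ne_of_mem_of_not_mem hu hvs)
      refine hstep (δ := (k + 1 : ℕ)) (Nat.abs_cast _) ?_ ?_
      · rw [hsums fun d => (d : ℤ)]
        push_cast
        simp only [sum_add_distrib, sum_const, nsmul_eq_mul, hs]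
        push_cast
        ring
      · rw [hsums fun d => (d : ℤ) ^ 2]
        push_cast
        simp only [add_sq, sum_add_distrib, sum_const, nsmul_eq_mul, ← sum_mul, ← mul_sum, hs]
        push_cast
        ring

theorem IsThreshold.exists_surplusSigma_eq [Fintype V] [DecidableEq V] [Nonempty V]
    (hG : IsThreshold G) :
    ∃ x, IsSurplusSeq x ∧ (G.sigmaTotal : ℚ) = surplusSigma (Fintype.card V) x := by
  obtain ⟨k, hk⟩ := Nat.exists_eq_succ_of_ne_zero (Fintype.card_ne_zero (α := V))
  obtain ⟨x, hx, -, hsigma⟩ := hG.exists_isSurplusSeq_degreeIn k univ hk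
  simp only [degreeIn_univ] at hsigma
  exact ⟨x, hx, by rw [sigmaTotal_eq_sum_degree, hk, ← hsigma]⟩

end

theorem sub_sq_div_eq {c T : ℚ} (hT : T ≠ 0) :
    c - c ^ 2 / T = (T ^ 2 - (2 * c - T) ^ 2) / (4 * T) := by
  field_simp
  ring

theorem cast_choose_two_pos {j : ℕ} (hj : 2 ≤ j) : (0 : ℚ) < j.choose 2 := by
  exact_mod_cast Nat.choose_pos hj

theorem pairBalance_eq_of_abs_eq {x : ℕ → ℤ} {j c : ℕ} (hj : 2 ≤ j)
    (h : |x j| = |2 * c - (j.choose 2 : ℤ)|) :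
    pairBalance x j = c - c ^ 2 / j.choose 2 := by
  have hsq : (x j : ℚ) ^ 2 = (2 * c - (j.choose 2 : ℚ)) ^ 2 := by
    exact_mod_cast (sq_eq_sq_iff_abs_eq_abs _ _).mpr h
  rw [pairBalance, sub_sq_div_eq (cast_choose_two_pos hj).ne', hsq]

theorem le_pairBalance_of_abs_le {x : ℕ → ℤ} {j c : ℕ} (hj : 2 ≤ j)
    (h : |x j| ≤ |2 * c - (j.choose 2 : ℤ)|) :
    c - (c : ℚ) ^ 2 / j.choose 2 ≤ pairBalance x j := by
  have hT := cast_choose_two_pos hj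
  have hsq : (x j : ℚ) ^ 2 ≤ (2 * c - (j.choose 2 : ℚ)) ^ 2 := by
    exact_mod_cast sq_le_sq.mpr h
  rw [pairBalance, sub_sq_div_eq hT.ne']
  gcongr

namespace IsSurplusSeq

variable {x : ℕ → ℤ} (hx : IsSurplusSeq x)
include hx

theorem abs_sub_le {j n : ℕ} (hjn : j ≤ n) :
    |x n - x j| ≤ n.choose 2 - (j.choose 2 : ℤ) := by
  induction n, hjn using Nat.le_induction with
  | base => simp
  | succ n _ ih =>
    rw [choose_two_succ]
    push_cast
    linarith [_root_.abs_sub_le (x (n + 1)) (x n) (x j), hx.step n]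

theorem abs_le_choose_two (j : ℕ) : |x j| ≤ j.choose 2 := by
  simpa [hx.zero] using hx.abs_sub_le j.zero_le

theorem exists_abs_add_choose_two_eq (j : ℕ) : ∃ h : ℕ, |x j| + j.choose 2 = 2 * (h : ℤ) := by
  have heven : Even (x j + j.choose 2) := by
    induction j with
    | zero => simp [hx.zero]
    | succ j ih =>
      have hj := hx.step j
      rw [choose_two_succ]
      push_cast
      grind
  obtain ⟨h, hh⟩ : Even (|x j| + j.choose 2) := by grind
  lift h to ℕ using by linarith [abs_nonneg (x j), Int.natCast_nonneg (j.choose 2)]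
  exact ⟨h, by rw [hh]; ring⟩

end IsSurplusSeq

/-- A lower bound for the balance of the first `j` vertices of a graph that ends with `h` edges
or `h` non-edges, whichever is larger; `b` is a cutoff below which `0` is used instead. -/
def balanceFloor (b h j : ℕ) : ℚ := if j ≤ b then 0 else h - (h : ℚ) ^ 2 / j.choose 2

/-- The upper bound for `surplusSigma n x` that results from replacing each balance below `n` by
`balanceFloor b h`. -/
def sigmaBound (n b h : ℕ) : ℚ := n * (b - 1) * h - 2 * (2 * b - n) * (h : ℚ) ^ 2 / b

theorem sum_balanceFloor {n b : ℕ} (hb : 1 ≤ b) (hbn : b < n) (h : ℕ) :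
    ∑ j ∈ range n, balanceFloor b h j =
      h * (n - 1 - b) - 2 * (h : ℚ) ^ 2 * (1 / b - 1 / (n - 1)) := by
  induction n, hbn using Nat.le_induction with
  | base =>
    rw [sum_eq_zero (f := balanceFloor b h) fun j hj =>
      if_pos (Nat.lt_succ_iff.mp (mem_range.mp hj))]
    push_cast
    ring
  | succ n hn ih =>
    have hn0 : (n : ℚ) ≠ 0 := Nat.cast_ne_zero.mpr (by omega)
    have hn1 : (n : ℚ) - 1 ≠ 0 := by
      have : (1 : ℚ) < n := by exact_mod_cast hb.trans_lt hn
      linarith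
    rw [sum_range_succ, ih, balanceFloor, if_neg (by omega), Nat.cast_choose_two, Nat.cast_succ,
      add_sub_cancel_right]
    field_simp
    ring

namespace IsSurplusSeq

variable {x : ℕ → ℤ} (hx : IsSurplusSeq x) {n b h : ℕ} (hh : |x n| + n.choose 2 = 2 * (h : ℤ))
include hx

theorem pairBalance_nonneg (j : ℕ) : 0 ≤ pairBalance x j := by
  have hsq : (x j : ℚ) ^ 2 ≤ (j.choose 2 : ℚ) ^ 2 := by
    have h : x j ^ 2 ≤ (j.choose 2 : ℤ) ^ 2 := sq_le_sq.mpr (by simpa using hx.abs_le_choose_two j)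
    exact_mod_cast h
  exact div_nonneg (sub_nonneg.mpr hsq) (by positivity)

include hh

theorem balanceFloor_le {j : ℕ} (hb : 1 ≤ b) (hj : j ≤ n) :
    balanceFloor b h j ≤ pairBalance x j := by
  rw [balanceFloor]
  split_ifs with hjb
  · exact hx.pairBalance_nonneg j
  · refine le_pairBalance_of_abs_le (by omega) (le_abs.mpr (Or.inl ?_))
    linarith [hx.abs_sub_le hj, abs_sub_abs_le_abs_sub (x j) (x n), abs_sub_comm (x j) (x n)]

theorem surplusSigma_add_le {i : ℕ} (hb : 1 ≤ b) (hbn : b < n) (hi : i < n) :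
    surplusSigma n x + n * (pairBalance x i - balanceFloor b h i) ≤ sigmaBound n b h := by
  have hfloor : ∑ j ∈ range n, balanceFloor b h j + (pairBalance x i - balanceFloor b h i) ≤
      ∑ j ∈ range n, pairBalance x j := by
    have := single_le_sum (f := fun j => pairBalance x j - balanceFloor b h j)
      (fun j hj => sub_nonneg.mpr (hx.balanceFloor_le hh hb (mem_range.mp hj).le))
      (mem_range.mpr hi)
    rw [sum_sub_distrib] at this
    linarith
  have htop : pairBalance x n = h - (h : ℚ) ^ 2 / n.choose 2 :=
    pairBalance_eq_of_abs_eq (by omega) (by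
      rw [← hh, add_sub_cancel_right, abs_abs])
  rw [sum_balanceFloor hb hbn] at hfloor
  have hb0 : (b : ℚ) ≠ 0 := by positivity
  have hn0 : (n : ℚ) ≠ 0 := Nat.cast_ne_zero.mpr (by omega)
  have hn1 : (n : ℚ) - 1 ≠ 0 := by
    have : (1 : ℚ) < n := by exact_mod_cast hb.trans_lt hbn
    linarith
  calc surplusSigma n x + n * (pairBalance x i - balanceFloor b h i)
      ≤ n * ((n - 2) * pairBalance x n -
          (h * (n - 1 - b) - 2 * (h : ℚ) ^ 2 * (1 / b - 1 / (n - 1)))) := by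
        rw [surplusSigma, ← mul_add]
        gcongr
        linarith
    _ = sigmaBound n b h := by
        rw [htop, sigmaBound, Nat.cast_choose_two]
        field_simp
        ring

theorem surplusSigma_le_sigmaBound (hb : 1 ≤ b) (hbn : b < n) :
    surplusSigma n x ≤ sigmaBound n b h := by
  refine le_trans ?_ (hx.surplusSigma_add_le hh hb hbn hbn)
  have := hx.balanceFloor_le hh hb hbn.le
  simpa using mul_nonneg n.cast_nonneg (sub_nonneg.mpr this)

end IsSurplusSeq

theorem exists_choose_two_add {n h : ℕ} (hn : 2 ≤ n) (hh : h ≤ n.choose 2) :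
    ∃ b r, 1 ≤ b ∧ b < n ∧ r ≤ b ∧ h = b.choose 2 + r := by
  induction n, hn using Nat.le_induction with
  | base => exact ⟨1, h, by simpa using hh⟩
  | succ n hn ih =>
    rw [choose_two_succ] at hh
    rcases le_total h (n.choose 2) with h1 | h1
    · obtain ⟨b, r, hb, hbn, h2⟩ := ih h1
      exact ⟨b, r, hb, by omega, h2⟩
    · exact ⟨n, h - n.choose 2, by omega⟩

theorem le_two_mul_of_choose_two_le {n b : ℕ} (hb : 1 ≤ b)
    (h : n.choose 2 ≤ 2 * (b + 1).choose 2) : n ≤ 2 * b := by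
  by_contra! hlt
  have hmono : (2 * b + 1).choose 2 ≤ n.choose 2 := Nat.choose_le_choose 2 hlt
  have hq : ((2 * b + 1).choose 2 : ℚ) ≤ 2 * (b + 1).choose 2 := by exact_mod_cast hmono.trans h
  rw [Nat.cast_choose_two, Nat.cast_choose_two] at hq
  push_cast at hq
  have hb' : (1 : ℚ) ≤ b := by exact_mod_cast hb
  nlinarith

/-- The `σ_t`-irregularity of the split graph with `b` independent vertices out of `n`. -/
def splitSigma (n b : ℕ) : ℚ := b * (n - b) * (b - 1) ^ 2

theorem splitSigma_succ (n b : ℕ) :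
    splitSigma n (b + 1) = splitSigma n b + b * (n * (3 * b - 1) - 4 * b ^ 2) := by
  simp only [splitSigma]
  push_cast
  ring

theorem sigmaBound_choose_two_add {n b r l : ℕ} (hb : 1 ≤ b) (hrl : r + l = b) :
    sigmaBound n b (b.choose 2 + r) = splitSigma n b +
      r * (n * (3 * b - 1) - 4 * b ^ 2 + 2 * (2 * b - n) * l / b) := by
  have hb0 : (b : ℚ) ≠ 0 := Nat.cast_ne_zero.mpr (by omega)
  have hl : (l : ℚ) = b - r := by rw [← hrl]; push_cast; ring
  rw [sigmaBound, splitSigma, Nat.cast_add, Nat.cast_choose_two, hl]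
  field_simp
  ring

theorem sigmaBound_choose_two_add_eq_succ_sub {n b r l : ℕ} (hb : 1 ≤ b) (hrl : r + l = b) :
    sigmaBound n b (b.choose 2 + r) = splitSigma n (b + 1) -
      l * (n * (3 * b - 1) - 4 * b ^ 2 - 2 * (2 * b - n) * r / b) := by
  have hb0 : (b : ℚ) ≠ 0 := Nat.cast_ne_zero.mpr (by omega)
  rw [sigmaBound_choose_two_add hb hrl, splitSigma_succ]
  field_simp
  rw [← hrl]
  push_cast
  ring

theorem sigmaBound_le_splitSigma {n b r l : ℕ} (hb : 1 ≤ b) (hn : n ≤ 2 * b) (hrl : r + l = b)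
    (h : 3 * n ≤ 4 * b) : sigmaBound n b (b.choose 2 + r) ≤ splitSigma n b := by
  have hlb : (l : ℚ) / b ≤ 1 := div_le_one_of_le₀ (by exact_mod_cast (by omega : l ≤ b)) (by simp)
  have hb' : (1 : ℚ) ≤ b := by exact_mod_cast hb
  have hn' : (n : ℚ) ≤ 2 * b := by exact_mod_cast hn
  have h' : (3 : ℚ) * n ≤ 4 * b := by exact_mod_cast h
  rw [sigmaBound_choose_two_add hb hrl, add_le_iff_nonpos_right, mul_div_assoc]
  refine mul_nonpos_of_nonneg_of_nonpos r.cast_nonneg ?_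
  calc (n : ℚ) * (3 * b - 1) - 4 * b ^ 2 + 2 * (2 * (b : ℚ) - n) * (l / b)
      ≤ n * (3 * b - 1) - 4 * b ^ 2 + 2 * (2 * (b : ℚ) - n) * 1 := by
        gcongr
    _ = (3 * (n : ℚ) - 4 * b) * (b - 1) := by ring
    _ ≤ 0 := mul_nonpos_of_nonpos_of_nonneg (by linarith) (by linarith)

theorem sigmaBound_le_splitSigma_succ {n b r l : ℕ} (hb : 1 ≤ b) (hn : n ≤ 2 * b)
    (hrl : r + l = b) (h : 4 * (b * (b + 1)) ≤ n * (3 * b + 1)) :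
    sigmaBound n b (b.choose 2 + r) ≤ splitSigma n (b + 1) := by
  have hrb : (r : ℚ) / b ≤ 1 := div_le_one_of_le₀ (by exact_mod_cast (by omega : r ≤ b)) (by simp)
  have hn' : (n : ℚ) ≤ 2 * b := by exact_mod_cast hn
  have h' : (4 : ℚ) * (b * (b + 1)) ≤ n * (3 * b + 1) := by exact_mod_cast h
  rw [sigmaBound_choose_two_add_eq_succ_sub hb hrl, sub_le_self_iff, mul_div_assoc]
  refine mul_nonneg l.cast_nonneg (sub_nonneg.mpr ?_)
  calc 2 * (2 * (b : ℚ) - n) * (r / b)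
      ≤ 2 * (2 * b - n) * 1 := by
        gcongr
    _ ≤ n * (3 * b - 1) - 4 * b ^ 2 := by linarith

theorem sigmaBound_choose_two_add_of_three_mul_eq_add_one {n b r l : ℕ} (hb : 1 ≤ b)
    (hrl : r + l = b) (hn : 3 * n = 4 * b + 1) :
    sigmaBound n b (b.choose 2 + r) = splitSigma n b + r * ((n - 1) * l / b - (n - b)) := by
  have hnq : 3 * (n : ℚ) = 4 * b + 1 := by exact_mod_cast hn
  have hconst : n * (3 * (b : ℚ) - 1) - 4 * b ^ 2 = -(n - b) := by linear_combination b * hnq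
  have hcoeff : 2 * (2 * (b : ℚ) - n) = n - 1 := by linear_combination -hnq
  rw [sigmaBound_choose_two_add hb hrl, hconst, hcoeff]
  ring

theorem sigmaBound_choose_two_add_of_three_mul_eq_add_two {n b r l : ℕ} (hb : 1 ≤ b)
    (hrl : r + l = b) (hn : 3 * n = 4 * b + 2) :
    sigmaBound n b (b.choose 2 + r) =
      splitSigma n (b + 1) + (n - 2) * (l * (r - l) / (2 * b)) := by
  have hb0 : (b : ℚ) ≠ 0 := Nat.cast_ne_zero.mpr (by omega)
  have hnq : 3 * (n : ℚ) = 4 * b + 2 := by exact_mod_cast hn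
  have hconst : n * (3 * (b : ℚ) - 1) - 4 * b ^ 2 = (n - 2) / 2 := by
    linear_combination (b - 1 / 2) * hnq
  have hcoeff : 2 * (2 * (b : ℚ) - n) = n - 2 := by linear_combination -hnq
  rw [sigmaBound_choose_two_add_eq_succ_sub hb hrl, hconst, hcoeff]
  field_simp
  rw [← hrl]
  push_cast
  ring

theorem add_le_choose_two {b l : ℕ} (h : 2 * l + 3 * b ≤ b ^ 2) : b + l ≤ b.choose 2 := by
  rw [Nat.choose_two_right, Nat.le_div_iff_mul_le two_pos, Nat.mul_sub, mul_one, ← sq]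
  omega

/-- The left side is the excess of `sigmaBound` over the split value in
`sigmaBound_choose_two_add_of_three_mul_eq_add_one`; the right side is the first slack in
`surplusSigma_add_le_or`. The next three lemmas are the other combinations. -/
theorem excess_add_one_le_slack {n b r l : ℕ} (hb : 3 ≤ b) (hrl : r + l = b) (hbn : b ≤ n) :
    (r : ℚ) * ((n - 1) * l / b - (n - b)) ≤ n * (l - (l : ℚ) ^ 2 / b.choose 2) := by
  have hbn' : (b : ℚ) ≤ n := by exact_mod_cast hbn
  have hbT : (b : ℚ) ≤ b.choose 2 := by
    exact_mod_cast add_le_choose_two (l := 0) (by nlinarith)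
  have : (0 : ℚ) < b := by exact_mod_cast (by omega : 0 < b)
  calc (r : ℚ) * ((n - 1) * l / b - (n - b))
      ≤ r * (n * l / b) := by
        gcongr
        have hlb : (0 : ℚ) ≤ l / b := by positivity
        rw [mul_div_assoc, mul_div_assoc]
        linarith
    _ = n * (l - (l : ℚ) ^ 2 / b) := by
        have hr : (r : ℚ) = b - l := by
          rw [← hrl]
          push_cast
          ring
        rw [hr]
        field_simp
    _ ≤ n * (l - (l : ℚ) ^ 2 / b.choose 2) := by gcongr

theorem excess_add_one_le_slack_succ {n b r l : ℕ} (hb : 5 ≤ b) (hrl : r + l = b)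
    (hn : 3 * n = 4 * b + 1) :
    (r : ℚ) * ((n - 1) * l / b - (n - b)) ≤
      n * (r * (1 - (b + l) / (b + 1).choose 2)) := by
  rcases r.eq_zero_or_pos with rfl | hr
  · simp
  have hnq : (n : ℚ) = (4 * b + 1) / 3 := by
    rw [eq_div_iff three_ne_zero]
    exact_mod_cast (mul_comm n 3).trans hn
  have hbq : (5 : ℚ) ≤ b := by exact_mod_cast hb
  have hl : (l : ℚ) ≤ b - 1 := le_sub_iff_add_le.mpr (by exact_mod_cast (by omega : l + 1 ≤ b))
  have hn1 : (1 : ℚ) ≤ n := by exact_mod_cast (by omega : 1 ≤ n)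
  have hb0 : (b : ℚ) ≠ 0 := by positivity
  have hmono : (n - 1) * (l : ℚ) / b + n * ((b + l) / (b + 1).choose 2) ≤
      (n - 1) * (b - 1) / b + n * ((b + (b - 1)) / (b + 1).choose 2) := by
    gcongr
  have hend : (n - 1) * ((b : ℚ) - 1) / b + n * ((b + (b - 1)) / (b + 1).choose 2) ≤
      2 * n - b := by
    have hfactor : 2 * (n : ℚ) - b -
        ((n - 1) * (b - 1) / b + n * ((b + (b - 1)) / (b + 1).choose 2)) =
        (b - 2) * (b - 5) / (3 * (b + 1)) := by
      rw [Nat.cast_choose_two, hnq, Nat.cast_succ, add_sub_cancel_right]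
      field_simp
      ring
    have : 0 ≤ ((b : ℚ) - 2) * (b - 5) / (3 * (b + 1)) :=
      div_nonneg (mul_nonneg (by linarith) (by linarith)) (by positivity)
    linarith
  rw [mul_left_comm]
  gcongr
  linarith

theorem excess_add_two_le_slack {n b r l : ℕ} (hb : 4 ≤ b) (hrl : r + l = b)
    (hlr : l ≤ r) :
    ((n : ℚ) - 2) * (l * (r - l) / (2 * b)) ≤ n * (l - (l : ℚ) ^ 2 / b.choose 2) := by
  have hlrq : (l : ℚ) ≤ r := by exact_mod_cast hlr
  have : (0 : ℚ) < b := by exact_mod_cast (by omega : 0 < b)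
  have hlT : 2 * (l : ℚ) ≤ b.choose 2 := by
    have := add_le_choose_two (b := b) (l := l) (by nlinarith)
    exact_mod_cast (by omega : 2 * l ≤ b.choose 2)
  have hT : (0 : ℚ) < b.choose 2 := cast_choose_two_pos (by omega)
  have hexcess : (l : ℚ) * (r - l) / (2 * b) ≤ l / 2 := by
    have hrb : (r : ℚ) - l ≤ b :=
      (sub_le_self _ l.cast_nonneg).trans (by exact_mod_cast (by omega : r ≤ b))
    calc (l : ℚ) * (r - l) / (2 * b) ≤ l * b / (2 * b) := by gcongr
      _ = l / 2 := by field_simp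
  have hslack : (l : ℚ) ^ 2 / b.choose 2 ≤ l / 2 := by
    rw [div_le_div_iff₀ hT two_pos]
    nlinarith [(l.cast_nonneg : (0 : ℚ) ≤ l)]
  have : 0 ≤ (l : ℚ) * (r - l) / (2 * b) :=
    div_nonneg (mul_nonneg l.cast_nonneg (sub_nonneg.mpr hlrq)) (by positivity)
  calc ((n : ℚ) - 2) * (l * (r - l) / (2 * b))
      ≤ n * (l * (r - l) / (2 * b)) := by gcongr; linarith
    _ ≤ n * (l - (l : ℚ) ^ 2 / b.choose 2) := by gcongr; linarith

theorem excess_add_two_le_slack_succ {n b r l : ℕ} (hb : 4 ≤ b) (hrl : r + l = b)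
    (hlr : l ≤ r) :
    ((n : ℚ) - 2) * (l * (r - l) / (2 * b)) ≤
      n * (r * (1 - (b + l) / (b + 1).choose 2)) := by
  have hlrq : (l : ℚ) ≤ r := by exact_mod_cast hlr
  have hbq : (4 : ℚ) ≤ b := by exact_mod_cast hb
  have hlb : 2 * (l : ℚ) ≤ b := by exact_mod_cast (by omega : 2 * l ≤ b)
  have : (0 : ℚ) ≤ l := l.cast_nonneg
  have hexcess : (l : ℚ) * (r - l) / (2 * b) ≤ r * (1 / 4) := by
    rw [div_le_iff₀ (by positivity)]
    nlinarith
  have hslack : ((b : ℚ) + l) / (b + 1).choose 2 ≤ 3 / 4 := by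
    rw [div_le_iff₀ (cast_choose_two_pos (by omega)), Nat.cast_choose_two]
    push_cast
    nlinarith
  have : 0 ≤ (l : ℚ) * (r - l) / (2 * b) :=
    div_nonneg (mul_nonneg l.cast_nonneg (sub_nonneg.mpr hlrq)) (by positivity)
  calc ((n : ℚ) - 2) * (l * (r - l) / (2 * b))
      ≤ n * (l * (r - l) / (2 * b)) := by gcongr; linarith
    _ ≤ n * (r * (1 / 4)) := by gcongr
    _ ≤ n * (r * (1 - (b + l) / (b + 1).choose 2)) := by gcongr; linarith

namespace IsSurplusSeq

variable {x : ℕ → ℤ} (hx : IsSurplusSeq x) {n b r l : ℕ} (hrl : r + l = b)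
  (hh : |x n| + n.choose 2 = 2 * ((b.choose 2 + r : ℕ) : ℤ))
include hx hrl hh

theorem abs_le_or_abs_succ_le (hbn : b < n) (hb : b + l ≤ b.choose 2) :
    |x b| ≤ b.choose 2 - 2 * l ∨ |x (b + 1)| ≤ b.choose 2 - b := by
  have hlip := hx.abs_sub_le (Nat.succ_le_of_lt hbn)
  have hsucc : |x (b + 1)| ≤ b.choose 2 + b - 2 * l := by
    have htri := abs_sub_abs_le_abs_sub (x (b + 1)) (x n)
    rw [Nat.succ_eq_add_one, choose_two_succ] at hlip
    push_cast at hlip hh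
    rw [abs_sub_comm] at htri
    omega
  have hstep := hx.step b
  have hle := hx.abs_le_choose_two b
  grind

/-- At the step from `b` to `b + 1` vertices the graph cannot stay at both ends of the range of
the balance allowed by its final value, so one of the floors has slack. -/
theorem surplusSigma_add_le_or (hbn : b + 1 < n) (hb : b + l ≤ b.choose 2) (hb2 : 2 ≤ b) :
    surplusSigma n x + n * (l - (l : ℚ) ^ 2 / b.choose 2) ≤ sigmaBound n b (b.choose 2 + r) ∨
    surplusSigma n x + n * (r * (1 - (b + l) / (b + 1).choose 2)) ≤
      sigmaBound n b (b.choose 2 + r) := by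
  have hlt : b < n := by omega
  refine (hx.abs_le_or_abs_succ_le hrl hh hlt hb).imp (fun hle => ?_) fun hle => ?_
  · refine le_trans ?_ (hx.surplusSigma_add_le hh (by omega) hlt hlt)
    have hbal := le_pairBalance_of_abs_le hb2 (c := l) (hle.trans (by
      rw [abs_sub_comm]
      exact le_abs_self _))
    rw [balanceFloor, if_pos le_rfl, sub_zero]
    gcongr
  · refine le_trans ?_ (hx.surplusSigma_add_le hh (by omega) hlt hbn)
    have hbal := le_pairBalance_of_abs_le (x := x) (j := b + 1) (c := b) (by omega) (hle.trans (by
      rw [abs_sub_comm, choose_two_succ]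
      push_cast
      exact (by ring : _ = _).trans_le (le_abs_self _)))
    have hT := cast_choose_two_pos (j := b + 1) (by omega)
    rw [balanceFloor, if_neg (by omega)]
    gcongr
    refine le_trans (le_of_eq ?_) (sub_le_sub_right hbal _)
    rw [choose_two_succ] at hT ⊢
    push_cast at hT ⊢
    rw [show (r : ℚ) = b - l by rw [← hrl]; push_cast; ring]
    field_simp
    ring

theorem surplusSigma_le_splitSigma_of_three_mul_eq_add_one (hn : 3 * n = 4 * b + 1) (hb : 2 ≤ b) :
    surplusSigma n x ≤ splitSigma n b := by
  rcases hb.eq_or_lt with rfl | hb3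
  · obtain rfl : n = 3 := by omega
    have hbound := hx.surplusSigma_le_sigmaBound (b := 2) hh (by omega) (by omega)
    rw [sigmaBound_choose_two_add_of_three_mul_eq_add_one (by omega) hrl hn] at hbound
    refine hbound.trans (add_le_of_nonpos_right ?_)
    obtain ⟨rfl, rfl⟩ | ⟨rfl, rfl⟩ | ⟨rfl, rfl⟩ :
        r = 0 ∧ l = 2 ∨ r = 1 ∧ l = 1 ∨ r = 2 ∧ l = 0 := by omega
    all_goals norm_num
  have hexcess := sigmaBound_choose_two_add_of_three_mul_eq_add_one (by omega) hrl hn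
  have hb5 : 5 ≤ b := by omega
  rcases hx.surplusSigma_add_le_or hrl hh (by omega)
    (add_le_choose_two (by nlinarith)) hb with h | h
  · linarith [excess_add_one_le_slack (n := n) (by omega) hrl (by omega)]
  · linarith [excess_add_one_le_slack_succ hb5 hrl hn]

theorem surplusSigma_le_splitSigma_of_three_mul_eq_add_two (hn : 3 * n = 4 * b + 2) (hb : 4 ≤ b) :
    surplusSigma n x ≤ splitSigma n (b + 1) := by
  have hexcess := sigmaBound_choose_two_add_of_three_mul_eq_add_two (by omega) hrl hn
  rcases le_total r l with hrle | hrle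
  · refine (hx.surplusSigma_le_sigmaBound (b := b) hh (by omega) (by omega)).trans ?_
    have hn2 : (2 : ℚ) ≤ n := by exact_mod_cast (by omega : 2 ≤ n)
    have hrleq : (r : ℚ) ≤ l := by exact_mod_cast hrle
    rw [hexcess, add_le_iff_nonpos_right]
    exact mul_nonpos_of_nonneg_of_nonpos (by linarith) (div_nonpos_of_nonpos_of_nonneg
      (mul_nonpos_of_nonneg_of_nonpos l.cast_nonneg (by linarith)) (by positivity))
  have hbT : b + l ≤ b.choose 2 := add_le_choose_two (by nlinarith)
  rcases hx.surplusSigma_add_le_or hrl hh (by omega) hbT (by omega) with h | h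
  · linarith [excess_add_two_le_slack (n := n) hb hrl hrle]
  · linarith [excess_add_two_le_slack_succ (n := n) hb hrl hrle]

end IsSurplusSeq

theorem IsSurplusSeq.exists_surplusSigma_le_splitSigma {x : ℕ → ℤ} (hx : IsSurplusSeq x) {n : ℕ}
    (hn : 3 ≤ n) : ∃ c, 1 ≤ c ∧ surplusSigma n x ≤ splitSigma n c := by
  obtain ⟨h, hh⟩ := hx.exists_abs_add_choose_two_eq n
  have hhn : h ≤ n.choose 2 := by
    have := hx.abs_le_choose_two n
    omega
  obtain ⟨b, r, hb, hbn, hrb, rfl⟩ := exists_choose_two_add (by omega) hhn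
  have hnb : n ≤ 2 * b := le_two_mul_of_choose_two_le hb (by
    rw [choose_two_succ]
    have := abs_nonneg (x n)
    omega)
  obtain ⟨l, hrl⟩ := Nat.exists_eq_add_of_le hrb
  replace hrl := hrl.symm
  have hbound := hx.surplusSigma_le_sigmaBound hh hb hbn
  rcases le_or_gt (3 * n) (4 * b) with hle | hlt
  · exact ⟨b, hb, hbound.trans (sigmaBound_le_splitSigma hb hnb hrl hle)⟩
  rcases le_or_gt (4 * (b * (b + 1))) (n * (3 * b + 1)) with hle | hgt
  · exact ⟨b + 1, by omega, hbound.trans (sigmaBound_le_splitSigma_succ hb hnb hrl hle)⟩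
  have hwindow : 3 * n < 4 * b + 3 := by nlinarith
  obtain h1 | h2 : 3 * n = 4 * b + 1 ∨ 3 * n = 4 * b + 2 := by omega
  · exact ⟨b, hb, hx.surplusSigma_le_splitSigma_of_three_mul_eq_add_one hrl hh h1 (by omega)⟩
  · exact ⟨b + 1, by omega,
      hx.surplusSigma_le_splitSigma_of_three_mul_eq_add_two hrl hh h2 (by omega)⟩

theorem splitSigma_mono {n c p : ℕ} (hc : 1 ≤ c) (hcp : c ≤ p) (hp : 4 * p ≤ 3 * n + 2) :
    splitSigma n c ≤ splitSigma n p := by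
  induction p, hcp using Nat.le_induction with
  | base => rfl
  | succ b hcb ih =>
    refine (ih (by omega)).trans ?_
    have hb : (1 : ℚ) ≤ b := by exact_mod_cast hc.trans hcb
    have hbn : 4 * (b : ℚ) + 2 ≤ 3 * n := by exact_mod_cast (by omega : 4 * b + 2 ≤ 3 * n)
    rw [splitSigma_succ]
    exact le_add_of_nonneg_right (mul_nonneg b.cast_nonneg (by nlinarith))

theorem splitSigma_anti {n c p : ℕ} (hpc : p ≤ c) (hp : 3 * n ≤ 4 * p + 1) :
    splitSigma n c ≤ splitSigma n p := by
  induction c, hpc using Nat.le_induction with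
  | base => rfl
  | succ b hpb ih =>
    refine le_trans ?_ ih
    have hbn : n * (3 * b) ≤ 4 * b ^ 2 + n := by
      rcases le_or_gt b n with hle | hlt <;> nlinarith
    have hbq : (n : ℚ) * (3 * b) ≤ 4 * b ^ 2 + n := by exact_mod_cast hbn
    rw [splitSigma_succ]
    exact add_le_of_nonpos_right
      (mul_nonpos_of_nonneg_of_nonpos b.cast_nonneg (by linarith))

section

variable {V : Type*} [Fintype V] [DecidableEq V] {G : SimpleGraph V} {a b : ℕ}

theorem sigmaTotal_le_of_card_eq [DecidableRel G.Adj] {n : ℕ} (hn : 3 ≤ n)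
    (hV : Fintype.card V = n) :
    G.sigmaTotal ≤ ((n + 1) / 4 : ℕ) * ((3 * n + 2) / 4 : ℕ) *
      ((n : ℤ) - 1 - ((n + 1) / 4 : ℕ)) ^ 2 := by
  set p := (3 * n + 2) / 4
  obtain ⟨H, _, hH, hGH⟩ := exists_isThreshold_sigmaTotal_le (hV.symm ▸ hn) G
  have : Nonempty V := Fintype.card_pos_iff.mp (by omega)
  obtain ⟨x, hx, hHx⟩ := hH.exists_surplusSigma_eq
  obtain ⟨c, hc, hxc⟩ := hx.exists_surplusSigma_le_splitSigma hn
  have hcp : splitSigma n c ≤ splitSigma n p :=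
    (le_total c p).elim (fun h => splitSigma_mono hc h (by omega))
      fun h => splitSigma_anti h (by omega)
  have hpn : (n : ℚ) = ((n + 1) / 4 : ℕ) + p := by exact_mod_cast (by omega : n = (n + 1) / 4 + p)
  rw [hV] at hHx
  have hq : (G.sigmaTotal : ℚ) ≤ ((n + 1) / 4 : ℕ) * p * (n - 1 - ((n + 1) / 4 : ℕ)) ^ 2 := by
    calc (G.sigmaTotal : ℚ) ≤ H.sigmaTotal := by exact_mod_cast hGH
      _ ≤ splitSigma n p := hHx.le.trans (hxc.trans hcp)
      _ = ((n + 1) / 4 : ℕ) * p * (n - 1 - ((n + 1) / 4 : ℕ)) ^ 2 := by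
        rw [splitSigma, hpn]
        ring
  rw [← @Int.cast_le ℚ]
  push_cast
  exact hq

theorem card_eq_of_isSplitGraph (h : G.IsSplitGraph a b) : Fintype.card V = a + b := by
  obtain ⟨A, B, hdisj, hunion, rfl, rfl, -⟩ := h
  rw [← card_univ, ← hunion, card_union_of_disjoint hdisj]

theorem connected_of_isSplitGraph (h : G.IsSplitGraph a b) (ha : 0 < a) : G.Connected := by
  obtain ⟨A, B, -, hunion, rfl, -, hA, -, hAB⟩ := h
  obtain ⟨c, hc⟩ := card_pos.mp ha
  refine connected_iff_exists_forall_reachable G |>.mpr ⟨c, fun v => ?_⟩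
  rcases eq_or_ne c v with rfl | hcv
  · exact Reachable.refl _
  rcases mem_union.mp (hunion ▸ mem_univ v) with hv | hv
  · exact (hA hc hv hcv).reachable
  · exact (hAB c hc v hv).reachable

theorem sigmaTotal_of_isSplitGraph [DecidableRel G.Adj] (h : G.IsSplitGraph a b) :
    G.sigmaTotal = a * b * ((b : ℤ) - 1) ^ 2 := by
  have hcard := card_eq_of_isSplitGraph h
  obtain ⟨A, B, hdisj, hunion, rfl, rfl, hA, hB, hAB⟩ := h
  have hmem (v : V) : v ∈ A ∨ v ∈ B := mem_union.mp (hunion ▸ mem_univ v)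
  have hdegA : ∀ v ∈ A, (G.degree v : ℤ) = #A + #B - 1 := fun v hv => by
    have hnbr : G.neighborFinset v = univ.erase v := by
      ext w
      rw [mem_neighborFinset, mem_erase, and_iff_left (mem_univ w)]
      exact ⟨fun hvw => hvw.ne', fun hwv =>
        (hmem w).elim (fun hw => hA hv hw hwv.symm) fun hw => hAB v hv w hw⟩
    rw [← card_neighborFinset_eq_degree, hnbr, cast_card_erase_of_mem (mem_univ v), card_univ,
      hcard, Nat.cast_add]
  have hdegB : ∀ v ∈ B, (G.degree v : ℤ) = #A := fun v hv => by
    have hnbr : G.neighborFinset v = A := by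
      ext w
      rw [mem_neighborFinset]
      exact ⟨fun hvw => (hmem w).resolve_right fun hw => hB hv hw hvw.ne hvw,
        fun hw => (hAB w hw v hv).symm⟩
    rw [← card_neighborFinset_eq_degree, hnbr]
  rw [sigmaTotal_eq_sum_degree, hcard, ← hunion, sum_union hdisj, sum_union hdisj,
    sum_congr rfl hdegA, sum_congr rfl hdegB, sum_congr rfl fun v hv => by rw [hdegA v hv],
    sum_congr (s₁ := B) rfl fun v hv => by rw [hdegB v hv]]
  simp only [sum_const, nsmul_eq_mul]
  push_cast
  ring

end

theorem exists_isSplitGraph {n a b : ℕ} (h : a + b = n) :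
    ∃ G : SimpleGraph (Fin n), G.IsSplitGraph a b := by
  have hcard : #{u : Fin n | (u : ℕ) < a} = a := by
    rw [Fin.card_filter_val_lt]
    omega
  refine ⟨SimpleGraph.fromRel fun u _ => (u : ℕ) < a, ({u | (u : ℕ) < a} : Finset (Fin n)),
    ({u | ¬ (u : ℕ) < a} : Finset (Fin n)), disjoint_filter_filter_not _ _ _,
    filter_union_filter_not_eq _ _, hcard, ?_, ?_, ?_, ?_⟩
  · have hsum := card_filter_add_card_filter_not (s := (univ : Finset (Fin n))) fun u => (u : ℕ) < a
    rw [hcard, card_univ, Fintype.card_fin] at hsum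
    omega
  · intro u hu v hv huv
    simp_all [fromRel_adj]
  · intro u hu v hv huv
    simp_all [fromRel_adj]
  · intro u hu v hv
    rw [mem_filter_univ] at hu hv
    exact ⟨fun huv => hv (huv ▸ hu), Or.inl hu⟩

theorem sigmaTotal_extremal {n : ℕ} (hn : 3 ≤ n) :
    (∀ (V : Type*) [Fintype V] [DecidableEq V] (G : SimpleGraph V) [DecidableRel G.Adj],
      Fintype.card V = n → G.sigmaTotal ≤
        ((n + 1) / 4 : ℕ) * ((3 * n + 2) / 4 : ℕ) * ((n : ℤ) - 1 - ((n + 1) / 4 : ℕ)) ^ 2) ∧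
    (∀ (V : Type*) [Fintype V] [DecidableEq V] (G : SimpleGraph V) [DecidableRel G.Adj],
      G.IsSplitGraph ((n + 1) / 4) ((3 * n + 2) / 4) →
        Fintype.card V = n ∧ G.Connected ∧ G.sigmaTotal =
        ((n + 1) / 4 : ℕ) * ((3 * n + 2) / 4 : ℕ) * ((n : ℤ) - 1 - ((n + 1) / 4 : ℕ)) ^ 2) ∧
    ∃ G : SimpleGraph (Fin n), G.IsSplitGraph ((n + 1) / 4) ((3 * n + 2) / 4) := by
  have hap : (n + 1) / 4 + (3 * n + 2) / 4 = n := by omega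
  have hp : (n : ℤ) - 1 - ((n + 1) / 4 : ℕ) = ((3 * n + 2) / 4 : ℕ) - 1 := by omega
  refine ⟨fun V _ _ G _ => sigmaTotal_le_of_card_eq hn, fun V _ _ G _ hG => ?_,
    exists_isSplitGraph hap⟩
  rw [hp]
  exact ⟨(card_eq_of_isSplitGraph hG).trans hap, connected_of_isSplitGraph hG (by omega),
    sigmaTotal_of_isSplitGraph hG⟩

theorem floor_natCast_div_four (m : ℕ) : ⌊(m : ℚ) / 4⌋ = (m / 4 : ℕ) := by
  exact_mod_cast Rat.floor_natCast_div_natCast m 4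

theorem ceil_natCast_div_four (m : ℕ) : ⌈(m : ℚ) / 4⌉ = ((m + 3) / 4 : ℕ) := by
  have h := Rat.ceil_natCast_div_natCast m 4
  rw [Nat.cast_ofNat] at h
  rw [h]
  omega

theorem theorem3p1_general (n : ℕ) (hn : 3 ≤ n) :
    (n % 4 = 0 ∨ n % 4 = 3 →
      (∀ (V : Type*) [Fintype V] [DecidableEq V] (G : SimpleGraph V) [DecidableRel G.Adj],
        Fintype.card V = n →
          G.sigmaTotal ≤ ⌈(n : ℚ) / 4⌉ * ⌊3 * (n : ℚ) / 4⌋ * ((n : ℤ) - 1 - ⌈(n : ℚ) / 4⌉) ^ 2) ∧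
      (∀ (V : Type*) [Fintype V] [DecidableEq V] (G : SimpleGraph V) [DecidableRel G.Adj],
        G.IsSplitGraph ⌈(n : ℚ) / 4⌉₊ ⌊3 * (n : ℚ) / 4⌋₊ →
          Fintype.card V = n ∧ G.Connected ∧
          G.sigmaTotal = ⌈(n : ℚ) / 4⌉ * ⌊3 * (n : ℚ) / 4⌋ * ((n : ℤ) - 1 - ⌈(n : ℚ) / 4⌉) ^ 2) ∧
      (∃ G : SimpleGraph (Fin n), G.IsSplitGraph ⌈(n : ℚ) / 4⌉₊ ⌊3 * (n : ℚ) / 4⌋₊)) ∧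
    (n % 4 = 1 ∨ n % 4 = 2 →
      (∀ (V : Type*) [Fintype V] [DecidableEq V] (G : SimpleGraph V) [DecidableRel G.Adj],
        Fintype.card V = n →
          G.sigmaTotal ≤ ⌊(n : ℚ) / 4⌋ * ⌈3 * (n : ℚ) / 4⌉ * ((n : ℤ) - 1 - ⌊(n : ℚ) / 4⌋) ^ 2) ∧
      (∀ (V : Type*) [Fintype V] [DecidableEq V] (G : SimpleGraph V) [DecidableRel G.Adj],
        G.IsSplitGraph ⌊(n : ℚ) / 4⌋₊ ⌈3 * (n : ℚ) / 4⌉₊ →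
          Fintype.card V = n ∧ G.Connected ∧
          G.sigmaTotal = ⌊(n : ℚ) / 4⌋ * ⌈3 * (n : ℚ) / 4⌉ * ((n : ℤ) - 1 - ⌊(n : ℚ) / 4⌋) ^ 2) ∧
      (∃ G : SimpleGraph (Fin n), G.IsSplitGraph ⌊(n : ℚ) / 4⌋₊ ⌈3 * (n : ℚ) / 4⌉₊)) := by
  have hcast : 3 * (n : ℚ) = (3 * n : ℕ) := by push_cast; rfl
  have hceil : ∀ m : ℕ, ⌈(m : ℚ) / 4⌉₊ = (m + 3) / 4 := fun m => by
    rw [← Int.ceil_toNat, ceil_natCast_div_four, Int.toNat_natCast]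
  have hfloor : ∀ m : ℕ, ⌊(m : ℚ) / 4⌋₊ = m / 4 := fun m => Nat.floor_div_eq_div m 4
  simp only [hcast, hceil, hfloor, ceil_natCast_div_four, floor_natCast_div_four]
  refine ⟨fun hmod => ?_, fun hmod => ?_⟩
  · rw [show (n + 3) / 4 = (n + 1) / 4 by omega, show 3 * n / 4 = (3 * n + 2) / 4 by omega]
    exact sigmaTotal_extremal hn
  · rw [show n / 4 = (n + 1) / 4 by omega, show (3 * n + 3) / 4 = (3 * n + 2) / 4 by omega]
    exact sigmaTotal_extremal hn

theorem theorem3p1 (n : ℕ) (hn : 3 ≤ n) :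
    (n % 4 = 0 ∨ n % 4 = 3 →
      (∀ (V : Type*) [Fintype V] [DecidableEq V] (G : SimpleGraph V) [DecidableRel G.Adj],
        Fintype.card V = n → G.Connected →
          G.sigmaTotal ≤ ⌈(n : ℚ) / 4⌉ * ⌊3 * (n : ℚ) / 4⌋ * ((n : ℤ) - 1 - ⌈(n : ℚ) / 4⌉) ^ 2) ∧
      (∀ (V : Type*) [Fintype V] [DecidableEq V] (G : SimpleGraph V) [DecidableRel G.Adj],
        G.IsSplitGraph ⌈(n : ℚ) / 4⌉₊ ⌊3 * (n : ℚ) / 4⌋₊ →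
          Fintype.card V = n ∧ G.Connected ∧
          G.sigmaTotal = ⌈(n : ℚ) / 4⌉ * ⌊3 * (n : ℚ) / 4⌋ * ((n : ℤ) - 1 - ⌈(n : ℚ) / 4⌉) ^ 2) ∧
      (∃ G : SimpleGraph (Fin n), G.IsSplitGraph ⌈(n : ℚ) / 4⌉₊ ⌊3 * (n : ℚ) / 4⌋₊)) ∧
    (n % 4 = 1 ∨ n % 4 = 2 →
      (∀ (V : Type*) [Fintype V] [DecidableEq V] (G : SimpleGraph V) [DecidableRel G.Adj],
        Fintype.card V = n → G.Connected →
          G.sigmaTotal ≤ ⌊(n : ℚ) / 4⌋ * ⌈3 * (n : ℚ) / 4⌉ * ((n : ℤ) - 1 - ⌊(n : ℚ) / 4⌋) ^ 2) ∧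
      (∀ (V : Type*) [Fintype V] [DecidableEq V] (G : SimpleGraph V) [DecidableRel G.Adj],
        G.IsSplitGraph ⌊(n : ℚ) / 4⌋₊ ⌈3 * (n : ℚ) / 4⌉₊ →
          Fintype.card V = n ∧ G.Connected ∧
          G.sigmaTotal = ⌊(n : ℚ) / 4⌋ * ⌈3 * (n : ℚ) / 4⌉ * ((n : ℤ) - 1 - ⌊(n : ℚ) / 4⌋) ^ 2) ∧
      (∃ G : SimpleGraph (Fin n), G.IsSplitGraph ⌊(n : ℚ) / 4⌋₊ ⌈3 * (n : ℚ) / 4⌉₊)) := by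
  exact (theorem3p1_general n hn).imp
    (fun h hmod => (h hmod).imp_left fun hle V _ _ G _ hV _ => hle V G hV)
    fun h hmod => (h hmod).imp_left fun hle V _ _ G _ hV _ => hle V G hV
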